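/- Let $n\ge 2$ and let $\rho:\mathbb{R}^n\to\mathbb{R}$ be a measurable function with compact support such that $0\le\rho\le 1$ almost everywhere and $\rho$ is nonzero on a set of positive Lebesgue measure. Here $\operatorname{supp}\rho$ denotes the (closed) support of the measure $\rho(\zeta)\,d\zeta$. Let $$E_\rho(x)=\exp\left[-\frac{2}{\omega_n}\int_{\mathbb{R}^n}\frac{\rho(\zeta)\,d\zeta}{|x-\zeta|^{n}}\right]$$ be the exponential transform of $\rho$, where $\omega_n$ is the $(n-1)$-dimensional measure of the unit sphere in $\mathbb{R}^n$. Then the function $$\begin{cases}\ln\bigl(1-E_\rho(x)\bigr), & \text{if } n=2,\\[4pt] \dfrac{1}{n-2}\bigl(1-E_\rho(x)\bigr)^{(n-2)/n}, & \text{if } n\ge 3,\end{cases}$$ is subharmonic in $\mathbb{R}^n\setminus\operatorname{supp}\rho$. (A function $u$ on an open set $\Omega$ is subharmonic if it is upper semicontinuous and, for every compact $K\subset\Omega$ and every function $h$ continuous on $K$ and harmonic in the interior of $K$, $u\le h$ on $\partial K$ implies $u\le h$ on $K$.) -/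

import Mathlib

open MeasureTheory

noncomputable section

namespace ExpTransform

/-- `u` is subharmonic on the open set `Ω`: it is upper semicontinuous there and it is dominated, on
every compact `K ⊆ Ω`, by each function that is continuous on `K`, harmonic in the interior of `K`
and at least `u` on the boundary of `K`. -/
def SubharmonicOn {n : ℕ} (u : EuclideanSpace ℝ (Fin n) → ℝ)
    (Ω : Set (EuclideanSpace ℝ (Fin n))) : Prop :=
  UpperSemicontinuousOn u Ω ∧
    ∀ K : Set (EuclideanSpace ℝ (Fin n)), IsCompact K → K ⊆ Ω →
      ∀ h : EuclideanSpace ℝ (Fin n) → ℝ, ContinuousOn h K →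
        InnerProductSpace.HarmonicOnNhd h (interior K) →
        (∀ x ∈ frontier K, u x ≤ h x) → ∀ x ∈ K, u x ≤ h x

/-- The support of a density `ρ ≥ 0`, i.e. the support of the measure `ρ dx`. -/
def densitySupport {n : ℕ} (ρ : EuclideanSpace ℝ (Fin n) → ℝ) :
    Set (EuclideanSpace ℝ (Fin n)) :=
  (volume.withDensity fun x => ENNReal.ofReal (ρ x)).support

/-- A density function: measurable, with values in `[0, 1]`, and compactly supported. As a density
is only relevant up to null sets, everything is required almost everywhere. -/
structure IsDensity {n : ℕ} (ρ : EuclideanSpace ℝ (Fin n) → ℝ) : Prop where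
  aemeasurable : AEMeasurable ρ volume
  nonneg : ∀ᵐ x, 0 ≤ ρ x
  le_one : ∀ᵐ x, ρ x ≤ 1
  isCompact_support : IsCompact (densitySupport ρ)

/-- `ω_n`, the `(n - 1)`-dimensional measure of the unit sphere of `ℝⁿ`. -/
def sphereArea (n : ℕ) : ℝ :=
  (volume : Measure (EuclideanSpace ℝ (Fin n))).toSphere.real Set.univ

open Classical in
/-- The exponential transform `E_ρ(x) = exp (-(2 / ω_n) ∫ ρ(ζ) / |x - ζ| ^ n dζ)`, with value
`exp (-∞) = 0` where the integral of this nonnegative function diverges. -/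
def expTransform {n : ℕ} (ρ : EuclideanSpace ℝ (Fin n) → ℝ)
    (x : EuclideanSpace ℝ (Fin n)) : ℝ :=
  if Integrable (fun ζ => ρ ζ / ‖x - ζ‖ ^ n) volume then
    Real.exp (-(2 / sphereArea n) * ∫ ζ, ρ ζ / ‖x - ζ‖ ^ n)
  else 0

end ExpTransform

end

/-!
Let `ν` be the measure with density `ρ`, `W = 1 - E_ρ` and `σ = ω_n`. Both functions are of the form
`H(W)` with `H'(w) = κ w ^ (-2/n)`, so subharmonicity amounts to `(2/n) |∇W|² ≤ W ΔW`. In terms of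
the field `F = ∫ |x - ζ| ^ (-n-2) (x - ζ) dν(ζ)`, the potential `A = ∫ |x - ζ| ^ (-n-2) dν(ζ)` and
`e = E_ρ(x)`, this reads `|F|² (1 - (1 - 2/n) e) ≤ (σ/n) (1 - e) A`.

For a vector `c` and `0 ≤ t < 1`, the kernel `(t² |c|² - |y - c|²) / |y| ^ (n+2)` is nonnegative
exactly where `|y - c| ≤ t |c|`, so by the bathtub principle its integral against `ν ≤ dx` is at
most its Lebesgue integral over that ball. The latter is computed in polar coordinates around `c`,
the spherical averages of `|y| ^ (-n-2)` being, up to a constant, the Laplacian of those of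
`|y| ^ (-n)`, which are found from a Poisson integral. Optimizing over `c` yields
`|F|² ≤ (σ/n) tⁿ A` whenever the potential of the ball is at least that of `ν`; a one-variable
inequality provides such a `t` with `tⁿ (1 - (1 - 2/n) e) = 1 - e`.
-/

noncomputable section

namespace ExpTransform

open Filter InnerProductSpace Laplacian MeasureTheory Metric Module Set Topology
open scoped Gradient Pointwise

section Laplacian

variable {E : Type*} [NormedAddCommGroup E] [InnerProductSpace ℝ E] {f g : E → ℝ} {x : E}

theorem eventually_hasGradientAt [CompleteSpace E] (hf : ContDiffAt ℝ 2 f x) :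
    ∀ᶠ y in 𝓝 x, HasGradientAt f (∇ f y) y :=
  (hf.eventually (by simp)).mono fun _ hy => (hy.differentiableAt (by simp)).hasGradientAt

theorem differentiableAt_gradient [CompleteSpace E] (hf : ContDiffAt ℝ 2 f x) :
    DifferentiableAt ℝ (∇ f) x :=
  (toDual ℝ E).symm.toContinuousLinearEquiv.differentiableAt.comp x
    ((hf.fderiv_right (m := 1) (by norm_num)).differentiableAt (by simp))

variable [FiniteDimensional ℝ E]

theorem laplacian_eq_trace {G : E → E} {G' : E →L[ℝ] E}
    (hf : ∀ᶠ y in 𝓝 x, HasGradientAt f (G y) y) (hG : HasFDerivAt G G' x) :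
    Δ f x = LinearMap.trace ℝ E G' := by
  have hfderiv : fderiv ℝ f =ᶠ[𝓝 x] fun y => toDual ℝ E (G y) :=
    hf.mono fun y hy => hy.hasFDerivAt.fderiv
  have hderiv : fderiv ℝ (fderiv ℝ f) x = (innerSL ℝ).comp G' := by
    rw [hfderiv.fderiv_eq]
    exact ((innerSL ℝ).hasFDerivAt.comp x hG).fderiv
  rw [laplacian_eq_iteratedFDeriv_stdOrthonormalBasis,
    LinearMap.trace_eq_sum_inner _ (stdOrthonormalBasis ℝ E)]
  simp [iteratedFDeriv_two_apply, hderiv, real_inner_comm]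

theorem laplacian_mul (hf : ContDiffAt ℝ 2 f x) (hg : ContDiffAt ℝ 2 g x) :
    Δ (fun y => f y * g y) x = f x * Δ g x + 2 * inner ℝ (∇ f x) (∇ g x) + g x * Δ f x := by
  have hgrad : ∀ᶠ y in 𝓝 x,
      HasGradientAt (fun z => f z * g z) (f y • ∇ g y + g y • ∇ f y) y := by
    filter_upwards [eventually_hasGradientAt hf, eventually_hasGradientAt hg] with y hfy hgy
    rw [hasGradientAt_iff_hasFDerivAt, map_add, map_smul, map_smul]
    exact hfy.hasFDerivAt.mul hgy.hasFDerivAt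
  have hf' := (differentiableAt_gradient hf).hasFDerivAt
  have hg' := (differentiableAt_gradient hg).hasFDerivAt
  have hfx := (eventually_hasGradientAt hf).self_of_nhds.hasFDerivAt
  have hgx := (eventually_hasGradientAt hg).self_of_nhds.hasFDerivAt
  rw [laplacian_eq_trace hgrad ((hfx.smul hg').add (hgx.smul hf')),
    laplacian_eq_trace (eventually_hasGradientAt hf) hf',
    laplacian_eq_trace (eventually_hasGradientAt hg) hg']
  simp only [ContinuousLinearMap.toLinearMap_add, ContinuousLinearMap.toLinearMap_smul,
    ContinuousLinearMap.coe_smulRight, map_add, map_smul, smul_eq_mul, LinearMap.trace_smulRight,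
    ContinuousLinearMap.coe_coe, toDual_apply_apply, real_inner_comm (∇ f x)]
  ring

theorem laplacian_comp {H H' : ℝ → ℝ} {H'' : ℝ} (hH : ∀ᶠ t in 𝓝 (f x), HasDerivAt H (H' t) t)
    (hH' : HasDerivAt H' H'' (f x)) (hf : ContDiffAt ℝ 2 f x) :
    Δ (fun y => H (f y)) x = H'' * ‖∇ f x‖ ^ 2 + H' (f x) * Δ f x := by
  have hgrad : ∀ᶠ y in 𝓝 x, HasGradientAt (fun z => H (f z)) (H' (f y) • ∇ f y) y := by
    filter_upwards [eventually_hasGradientAt hf, hf.continuousAt.eventually hH] with y hfy hHy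
    rw [hasGradientAt_iff_hasFDerivAt, map_smul]
    exact hHy.comp_hasFDerivAt y hfy.hasFDerivAt
  have hf' := (differentiableAt_gradient hf).hasFDerivAt
  have hfx := (eventually_hasGradientAt hf).self_of_nhds.hasFDerivAt
  rw [laplacian_eq_trace hgrad ((hH'.comp_hasFDerivAt x hfx).smul hf'),
    laplacian_eq_trace (eventually_hasGradientAt hf) hf']
  simp only [Function.comp_apply, ContinuousLinearMap.toLinearMap_add,
    ContinuousLinearMap.toLinearMap_smul, ContinuousLinearMap.coe_smulRight, map_add, map_smul,
    smul_eq_mul, LinearMap.trace_smulRight, LinearMap.smul_apply, ContinuousLinearMap.coe_coe,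
    toDual_apply_apply, real_inner_self_eq_norm_sq]
  ring

theorem hasGradientAt_norm_sq (x : E) : HasGradientAt (fun y : E => ‖y‖ ^ 2) ((2 : ℝ) • x) x := by
  rw [hasGradientAt_iff_hasFDerivAt, map_smul, ofNat_smul_eq_nsmul]
  exact (hasStrictFDerivAt_norm_sq x).hasFDerivAt

theorem laplacian_norm_sq (x : E) : Δ (fun y : E => ‖y‖ ^ 2) x = 2 * finrank ℝ E := by
  rw [laplacian_eq_trace (.of_forall hasGradientAt_norm_sq)
    ((hasFDerivAt_id x).const_smul (2 : ℝ))]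
  simp

end Laplacian

section MaximumPrinciple

theorem deriv_deriv_nonpos_of_isLocalMax {f : ℝ → ℝ} {a : ℝ} (hf : ContinuousAt f a)
    (hmax : IsLocalMax f a) : deriv (deriv f) a ≤ 0 := by
  by_contra! hpos
  have hmin : IsLocalMin f a := isLocalMin_of_deriv_deriv_pos hpos hmax.deriv_eq_zero hf
  have hconst : f =ᶠ[𝓝 a] fun _ => f a := by
    filter_upwards [hmax, hmin] with t h₁ h₂ using le_antisymm h₁ h₂
  have hderiv : deriv f =ᶠ[𝓝 a] fun _ => 0 := by simpa using hconst.deriv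
  exact hpos.ne' (by simpa using hderiv.deriv_eq)

section NormedSpace

variable {E : Type*} [NormedAddCommGroup E] [NormedSpace ℝ E]

theorem hasDerivAt_line (x e : E) (t : ℝ) : HasDerivAt (fun s : ℝ => x + s • e) e t := by
  simpa using ((hasDerivAt_id t).smul_const e).const_add x

theorem iteratedFDeriv_two_nonpos_of_isLocalMax {f : E → ℝ} {x : E} (hf : ContDiffAt ℝ 2 f x)
    (hmax : IsLocalMax f x) (e : E) : iteratedFDeriv ℝ 2 f x ![e, e] ≤ 0 := by
  have hline : Tendsto (fun s : ℝ => x + s • e) (𝓝 0) (𝓝 x) := by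
    simpa using (hasDerivAt_line x e 0).continuousAt.tendsto
  have hderiv : deriv (fun s : ℝ => f (x + s • e)) =ᶠ[𝓝 0] fun s => fderiv ℝ f (x + s • e) e := by
    filter_upwards [hline.eventually (hf.eventually (by simp))] with s hs
    exact ((hs.differentiableAt (by simp)).hasFDerivAt.comp_hasDerivAt s
      (hasDerivAt_line x e s)).deriv
  have hfderiv :
      HasDerivAt (fun s : ℝ => fderiv ℝ f (x + s • e)) (fderiv ℝ (fderiv ℝ f) x e) 0 := by
    refine HasFDerivAt.comp_hasDerivAt (l := fderiv ℝ f) 0 ?_ (hasDerivAt_line x e 0)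
    simpa using ((hf.fderiv_right (m := 1) (by norm_num)).differentiableAt (by simp)).hasFDerivAt
  have hsecond : deriv (deriv fun s : ℝ => f (x + s • e)) 0 = iteratedFDeriv ℝ 2 f x ![e, e] := by
    rw [hderiv.deriv_eq, (hfderiv.clm_apply (hasDerivAt_const 0 e)).deriv]
    simp [iteratedFDeriv_two_apply]
  rw [← hsecond]
  refine deriv_deriv_nonpos_of_isLocalMax
    (ContinuousAt.comp (g := f) (by simpa using hf.continuousAt) (by fun_prop)) ?_
  simpa [IsLocalMax, IsMaxFilter] using hline.eventually hmax

end NormedSpace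

variable {E : Type*} [NormedAddCommGroup E] [InnerProductSpace ℝ E] [FiniteDimensional ℝ E]
  {K : Set E} {f : E → ℝ}

theorem laplacian_nonpos_of_isLocalMax {x : E} (hf : ContDiffAt ℝ 2 f x)
    (hmax : IsLocalMax f x) : Δ f x ≤ 0 := by
  rw [laplacian_eq_iteratedFDeriv_stdOrthonormalBasis]
  exact Finset.sum_nonpos fun i _ => iteratedFDeriv_two_nonpos_of_isLocalMax hf hmax _

theorem le_of_laplacian_pos {M : ℝ} (hK : IsCompact K) (hc : ContinuousOn f K)
    (hf : ∀ x ∈ interior K, ContDiffAt ℝ 2 f x) (hΔ : ∀ x ∈ interior K, 0 < Δ f x)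
    (hM : ∀ x ∈ frontier K, f x ≤ M) : ∀ x ∈ K, f x ≤ M := by
  intro x hx
  obtain ⟨x₀, hx₀, hmax⟩ := hK.exists_isMaxOn ⟨x, hx⟩ hc
  have hx₀int : x₀ ∉ interior K := fun hint =>
    (hΔ x₀ hint).not_ge <| laplacian_nonpos_of_isLocalMax (hf x₀ hint) <|
      hmax.isLocalMax (mem_interior_iff_mem_nhds.1 hint)
  exact (hmax hx).trans (hM x₀ ⟨subset_closure hx₀, hx₀int⟩)

variable [Nontrivial E]

theorem le_of_laplacian_nonneg {M : ℝ} (hK : IsCompact K) (hc : ContinuousOn f K)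
    (hf : ∀ x ∈ interior K, ContDiffAt ℝ 2 f x) (hΔ : ∀ x ∈ interior K, 0 ≤ Δ f x)
    (hM : ∀ x ∈ frontier K, f x ≤ M) : ∀ x ∈ K, f x ≤ M := by
  obtain ⟨R, hR⟩ : ∃ R, ∀ x ∈ K, ‖x‖ ≤ R := hK.isBounded.exists_norm_le
  have hsq (y : E) : ContDiffAt ℝ 2 (fun z : E => ‖z‖ ^ 2) y := (contDiff_norm_sq ℝ).contDiffAt
  have hεsq (ε : ℝ) (y : E) : ContDiffAt ℝ 2 (ε • fun z : E => ‖z‖ ^ 2) y := (hsq y).const_smul ε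
  have hperturbed (ε : ℝ) (hε : 0 < ε) (x : E) (hx : x ∈ K) : f x ≤ M + ε * R ^ 2 := by
    have hmax := le_of_laplacian_pos (f := f + ε • fun y => ‖y‖ ^ 2) (M := M + ε * R ^ 2) hK
      (hc.add (by fun_prop)) (fun y hy => (hf y hy).add (hεsq ε y))
      (fun y hy => by
        rw [ContDiffAt.laplacian_add (hf y hy) (hεsq ε y), laplacian_smul ε (hsq y),
          laplacian_norm_sq, smul_eq_mul]
        have := hΔ y hy
        have : (0 : ℝ) < finrank ℝ E := by exact_mod_cast finrank_pos
        positivity)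
      (fun y hy => by
        have := hM y hy
        have := hR y (hK.isClosed.frontier_subset hy)
        simp only [Pi.add_apply, Pi.smul_apply, smul_eq_mul]
        gcongr) x hx
    simp only [Pi.add_apply, Pi.smul_apply, smul_eq_mul] at hmax
    nlinarith [sq_nonneg ‖x‖]
  intro x hx
  have hlim : Tendsto (fun ε : ℝ => M + ε * R ^ 2) (𝓝[>] 0) (𝓝 (M + 0 * R ^ 2)) :=
    (by fun_prop : Continuous fun ε : ℝ => M + ε * R ^ 2).tendsto 0 |>.mono_left nhdsWithin_le_nhds
  simpa using ge_of_tendsto hlim (eventually_mem_nhdsWithin.mono fun ε hε => hperturbed ε hε x hx)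

theorem eq_of_harmonicOnNhd {c : ℝ} (hK : IsCompact K) (hc : ContinuousOn f K)
    (hf : HarmonicOnNhd f (interior K)) (hfc : ∀ x ∈ frontier K, f x = c) : ∀ x ∈ K, f x = c := by
  intro x hx
  refine le_antisymm (le_of_laplacian_nonneg hK hc (fun y hy => (hf y hy).1)
    (fun y hy => (hf y hy).2.self_of_nhds.ge) (fun y hy => (hfc y hy).le) x hx) ?_
  refine neg_le_neg_iff.1 (le_of_laplacian_nonneg (f := -f) hK hc.neg (fun y hy => (hf y hy).1.neg)
    (fun y hy => ?_) (fun y hy => (neg_le_neg (hfc y hy).ge)) x hx)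
  rw [laplacian_neg, Pi.neg_apply, (hf y hy).2.self_of_nhds]
  simp

end MaximumPrinciple

section Subharmonic

variable {n : ℕ} {u v : EuclideanSpace ℝ (Fin n) → ℝ} {Ω : Set (EuclideanSpace ℝ (Fin n))}

theorem SubharmonicOn.congr (hu : SubharmonicOn u Ω) (huv : EqOn v u Ω) : SubharmonicOn v Ω := by
  refine ⟨fun x hx y hy => ?_, fun K hK hKΩ h hh hharm hle x hx => ?_⟩
  · filter_upwards [hu.1 x hx y ((huv hx).symm.trans_lt hy), self_mem_nhdsWithin] with z hz hzΩ
    exact (huv hzΩ).trans_lt hz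
  rw [huv (hKΩ hx)]
  refine hu.2 K hK hKΩ h hh hharm (fun y hy => ?_) x hx
  rw [← huv (hKΩ (hK.isClosed.frontier_subset hy))]
  exact hle y hy

theorem subharmonicOn_of_laplacian_nonneg [NeZero n] (hu : ∀ x ∈ Ω, ContDiffAt ℝ 2 u x)
    (hΔ : ∀ x ∈ Ω, 0 ≤ Δ u x) : SubharmonicOn u Ω := by
  have hcont : ContinuousOn u Ω := fun x hx => (hu x hx).continuousAt.continuousWithinAt
  refine ⟨hcont.upperSemicontinuousOn, fun K hK hKΩ h hh hharm hle x hx => ?_⟩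
  have hint {y} (hy : y ∈ interior K) : y ∈ Ω := hKΩ (interior_subset hy)
  refine sub_nonpos.1 (le_of_laplacian_nonneg (f := u - h) hK ((hcont.mono hKΩ).sub hh)
    (fun y hy => (hu y (hint hy)).sub (hharm y hy).1) (fun y hy => ?_)
    (fun y hy => sub_nonpos.2 (hle y hy)) x hx)
  rw [(hu y (hint hy)).laplacian_sub (hharm y hy).1, (hharm y hy).2.self_of_nhds]
  simpa using hΔ y (hint hy)

end Subharmonic

section Kernel

variable {E F : Type*} [NormedAddCommGroup E] [NormedAddCommGroup F]

/-- A convolution kernel that is regular away from the origin: continuous there, and bounded on the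
complement of each ball around the origin. Its values near the origin are irrelevant. -/
structure IsRegularKernel (k : E → F) : Prop where
  continuousOn : ContinuousOn k {0}ᶜ
  bounded : ∀ δ > 0, ∃ C, ∀ y, δ ≤ ‖y‖ → ‖k y‖ ≤ C

theorem IsRegularKernel.of_norm_le {k : E → F} {C : ℝ} {m : ℕ} (hk : ContinuousOn k {0}ᶜ)
    (hC : ∀ y ≠ 0, ‖k y‖ ≤ C * (‖y‖ ^ m)⁻¹) : IsRegularKernel k := by
  refine ⟨hk, fun δ hδ => ⟨|C| * (δ ^ m)⁻¹, fun y hy => ?_⟩⟩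
  refine (hC y (norm_pos_iff.1 (hδ.trans_le hy))).trans ?_
  gcongr
  exact le_abs_self C

theorem IsRegularKernel.clm_comp {G : Type*} [NormedSpace ℝ F] [NormedAddCommGroup G]
    [NormedSpace ℝ G] {k : E → F} (hk : IsRegularKernel k) (L : F →L[ℝ] G) :
    IsRegularKernel fun y => L (k y) := by
  refine ⟨L.continuous.comp_continuousOn hk.continuousOn, fun δ hδ => ?_⟩
  obtain ⟨C, hC⟩ := hk.bounded δ hδ
  exact ⟨‖L‖ * C, fun y hy => (L.le_opNorm _).trans (by gcongr; exact hC y hy)⟩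

variable [MeasurableSpace E] {ν : Measure E} {x : E} {k : E → F}

theorem exists_ae_le_norm_sub (hx : x ∉ ν.support) :
    ∃ δ > 0, ∀ᵐ ζ ∂ν, ∀ y ∈ ball x δ, δ ≤ ‖y - ζ‖ := by
  obtain ⟨U, hU, hνU⟩ := Measure.notMem_support_iff_exists.1 hx
  obtain ⟨ε, hε, hεU⟩ := Metric.mem_nhds_iff.1 hU
  refine ⟨ε / 2, half_pos hε, ?_⟩
  filter_upwards [measure_eq_zero_iff_ae_notMem.1 (measure_mono_null hεU hνU)] with ζ hζ y hy
  rw [mem_ball, not_lt, dist_comm] at hζ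
  rw [mem_ball'] at hy
  rw [← dist_eq_norm]
  linarith [dist_triangle x y ζ]

variable [BorelSpace E] [SecondCountableTopology E]

theorem IsRegularKernel.aestronglyMeasurable (hk : IsRegularKernel k)
    (hx : ∀ᵐ ζ ∂ν, x - ζ ≠ 0) : AEStronglyMeasurable (fun ζ => k (x - ζ)) ν := by
  rw [← Measure.restrict_eq_self_of_ae_mem (s := {ζ | x - ζ ≠ 0}) hx]
  have hcomp : ContinuousOn (fun ζ => k (x - ζ)) {ζ | x - ζ ≠ 0} :=
    hk.continuousOn.comp (by fun_prop) fun ζ hζ => hζ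
  exact hcomp.aestronglyMeasurable
    (isOpen_ne_fun (by fun_prop) (by fun_prop)).measurableSet

variable [IsFiniteMeasure ν]

theorem IsRegularKernel.integrable (hk : IsRegularKernel k) (hx : x ∉ ν.support) :
    Integrable (fun ζ => k (x - ζ)) ν := by
  obtain ⟨δ, hδ, hfar⟩ := exists_ae_le_norm_sub hx
  obtain ⟨C, hC⟩ := hk.bounded δ hδ
  have hfar' : ∀ᵐ ζ ∂ν, δ ≤ ‖x - ζ‖ := hfar.mono fun ζ hζ => hζ x (mem_ball_self hδ)
  exact .of_bound (hk.aestronglyMeasurable <| hfar'.mono fun ζ hζ =>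
    norm_pos_iff.1 (hδ.trans_le hζ)) C (hfar'.mono fun ζ hζ => hC _ hζ)

variable [NormedSpace ℝ F]

theorem IsRegularKernel.continuousAt_integral (hk : IsRegularKernel k) (hx : x ∉ ν.support) :
    ContinuousAt (fun y => ∫ ζ, k (y - ζ) ∂ν) x := by
  obtain ⟨δ, hδ, hfar⟩ := exists_ae_le_norm_sub hx
  obtain ⟨C, hC⟩ := hk.bounded δ hδ
  have hne : ∀ᵐ ζ ∂ν, ∀ y ∈ ball x δ, y - ζ ≠ 0 := hfar.mono fun ζ hζ y hy =>
    norm_pos_iff.1 (hδ.trans_le (hζ y hy))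
  have hball := ball_mem_nhds x hδ
  refine continuousAt_of_dominated (bound := fun _ => C) ?_ ?_ (integrable_const C) ?_
  · filter_upwards [hball] with y hy
    exact hk.aestronglyMeasurable (hne.mono fun ζ hζ => hζ y hy)
  · filter_upwards [hball] with y hy
    exact hfar.mono fun ζ hζ => hC _ (hζ y hy)
  · filter_upwards [hne] with ζ hζ
    have hkx := hk.continuousOn.continuousAt
      (isOpen_compl_singleton.mem_nhds (hζ x (mem_ball_self hδ)))
    exact hkx.comp (f := fun y => y - ζ) (by fun_prop)

theorem IsRegularKernel.hasFDerivAt_integral [NormedSpace ℝ E] {k' : E → E →L[ℝ] F}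
    (hk : IsRegularKernel k) (hk' : IsRegularKernel k') (hderiv : ∀ y ≠ 0, HasFDerivAt k (k' y) y)
    (hx : x ∉ ν.support) :
    HasFDerivAt (fun y => ∫ ζ, k (y - ζ) ∂ν) (∫ ζ, k' (x - ζ) ∂ν) x := by
  obtain ⟨δ, hδ, hfar⟩ := exists_ae_le_norm_sub hx
  obtain ⟨C, hC⟩ := hk'.bounded δ hδ
  have hne : ∀ᵐ ζ ∂ν, ∀ y ∈ ball x δ, y - ζ ≠ 0 := hfar.mono fun ζ hζ y hy =>
    norm_pos_iff.1 (hδ.trans_le (hζ y hy))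
  have hball := ball_mem_nhds x hδ
  refine hasFDerivAt_integral_of_dominated_of_fderiv_le (F' := fun y ζ => k' (y - ζ))
    (bound := fun _ => C) hball ?_ (hk.integrable hx) (hk'.integrable hx).aestronglyMeasurable ?_
    (integrable_const C) ?_
  · filter_upwards [hball] with y hy
    exact hk.aestronglyMeasurable (hne.mono fun ζ hζ => hζ y hy)
  · exact hfar.mono fun ζ hζ y hy => hC _ (hζ y hy)
  · filter_upwards [hne] with ζ hζ y hy
    exact (hderiv _ (hζ y hy)).comp y ((hasFDerivAt_id y).sub_const ζ)

end Kernel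

section RieszKernel

variable {E : Type*} [NormedAddCommGroup E]

theorem continuousOn_inv_norm_pow (m : ℕ) : ContinuousOn (fun y : E => (‖y‖ ^ m)⁻¹) {0}ᶜ :=
  ContinuousOn.inv₀ (by fun_prop) fun _ hy => pow_ne_zero m (norm_ne_zero_iff.2 hy)

theorem isRegularKernel_inv_norm_pow (m : ℕ) : IsRegularKernel fun y : E => (‖y‖ ^ m)⁻¹ :=
  .of_norm_le (C := 1) (m := m) (continuousOn_inv_norm_pow m) fun y _ => by simp

variable [InnerProductSpace ℝ E]

theorem hasFDerivAt_norm {y : E} (hy : y ≠ 0) :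
    HasFDerivAt (fun z : E => ‖z‖) (‖y‖⁻¹ • innerSL ℝ y) y := by
  have hsqrt := (hasStrictFDerivAt_norm_sq y).hasFDerivAt.sqrt (by positivity)
  simp only [Real.sqrt_sq (norm_nonneg _)] at hsqrt
  refine hsqrt.congr_fderiv ?_
  rw [← ofNat_smul_eq_nsmul ℝ, smul_smul]
  congr 1
  field_simp

theorem hasFDerivAt_inv_norm_pow (m : ℕ) {y : E} (hy : y ≠ 0) :
    HasFDerivAt (fun z : E => (‖z‖ ^ m)⁻¹)
      ((-(m : ℝ) • innerSL ℝ) ((‖y‖ ^ (m + 2))⁻¹ • y)) y := by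
  have hy' : ‖y‖ ≠ 0 := norm_ne_zero_iff.2 hy
  have hpow := (hasDerivAt_zpow (-(m : ℤ)) ‖y‖ (.inl hy')).comp_hasFDerivAt y (hasFDerivAt_norm hy)
  refine (hpow.congr_of_eventuallyEq (.of_forall fun z => ?_)).congr_fderiv ?_
  · simp [zpow_neg]
  · rw [smul_apply, map_smul, smul_smul, smul_smul, zpow_sub_one₀ hy', zpow_neg,
      zpow_natCast, pow_add]
    congr 1
    push_cast
    field_simp

/-- The derivative at `y` of the vector field `y ↦ ‖y‖ ^ (-m) • y`. -/
def rieszFieldDeriv (m : ℕ) (y : E) : E →L[ℝ] E :=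
  (‖y‖ ^ m)⁻¹ • ContinuousLinearMap.id ℝ E
    + ((-(m : ℝ) • innerSL ℝ) ((‖y‖ ^ (m + 2))⁻¹ • y)).smulRight y

theorem hasFDerivAt_inv_norm_pow_smul (m : ℕ) {y : E} (hy : y ≠ 0) :
    HasFDerivAt (fun z : E => (‖z‖ ^ m)⁻¹ • z) (rieszFieldDeriv m y) y :=
  (hasFDerivAt_inv_norm_pow m hy).smul (hasFDerivAt_id y)

theorem isRegularKernel_inv_norm_pow_smul (m : ℕ) :
    IsRegularKernel fun y : E => (‖y‖ ^ (m + 1))⁻¹ • y := by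
  refine .of_norm_le (C := 1) (m := m) ((continuousOn_inv_norm_pow _).smul continuousOn_id)
    fun y hy => ?_
  have : ‖y‖ ≠ 0 := norm_ne_zero_iff.2 hy
  rw [norm_smul, norm_inv, norm_pow, norm_norm, pow_succ]
  field_simp
  rfl

theorem isRegularKernel_rieszFieldDeriv (m : ℕ) : IsRegularKernel (rieszFieldDeriv (E := E) m) := by
  have hcont (j : ℕ) := continuousOn_inv_norm_pow (E := E) j
  have hright : ContinuousOn (fun y : E =>
      ((-(m : ℝ) • innerSL ℝ) ((‖y‖ ^ (m + 2))⁻¹ • y)).smulRight y) {0}ᶜ :=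
    isBoundedBilinearMap_smulRight.continuous.comp_continuousOn
      (((ContinuousLinearMap.continuous _).comp_continuousOn
        ((hcont (m + 2)).smul continuousOn_id)).prodMk continuousOn_id)
  refine .of_norm_le (C := 1 + m) (m := m) (((hcont m).smul continuousOn_const).add hright)
    fun y hy => ?_
  have : 0 < ‖y‖ := norm_pos_iff.2 hy
  calc ‖rieszFieldDeriv m y‖
      ≤ (‖y‖ ^ m)⁻¹ * 1 + (‖y‖ ^ (m + 2))⁻¹ * (m * ‖y‖) * ‖y‖ := by
        refine (norm_add_le _ _).trans (add_le_add ?_ ?_)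
        · rw [norm_smul, norm_inv, norm_pow, norm_norm]
          gcongr
          exact ContinuousLinearMap.norm_id_le
        · simp [norm_smul]
    _ = (1 + m) * (‖y‖ ^ m)⁻¹ := by
        field_simp
        ring

variable [FiniteDimensional ℝ E]

theorem trace_rieszFieldDeriv (m : ℕ) {y : E} (hy : y ≠ 0) :
    LinearMap.trace ℝ E (rieszFieldDeriv m y) = (finrank ℝ E - m) * (‖y‖ ^ m)⁻¹ := by
  have hradial : (-(m : ℝ) • innerSL ℝ) ((‖y‖ ^ (m + 2))⁻¹ • y) y = -m * (‖y‖ ^ m)⁻¹ := by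
    have : ‖y‖ ≠ 0 := norm_ne_zero_iff.2 hy
    rw [smul_apply, smul_apply, map_smul, smul_apply, innerSL_apply_apply,
      real_inner_self_eq_norm_sq, smul_eq_mul, smul_eq_mul]
    field_simp
    ring
  rw [rieszFieldDeriv, ContinuousLinearMap.toLinearMap_add, ContinuousLinearMap.toLinearMap_smul,
    ContinuousLinearMap.coe_id, ContinuousLinearMap.coe_smulRight, map_add, map_smul,
    LinearMap.trace_id, LinearMap.trace_smulRight, ContinuousLinearMap.coe_coe, hradial,
    smul_eq_mul]
  ring

end RieszKernel

section RieszPotential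

variable {E : Type*} [NormedAddCommGroup E] [MeasurableSpace E]

/-- The Riesz potential `∫ |x - ζ| ^ (-m) dν(ζ)`. -/
def rieszPotential (ν : Measure E) (m : ℕ) (x : E) : ℝ :=
  ∫ ζ, (‖x - ζ‖ ^ m)⁻¹ ∂ν

theorem rieszPotential_nonneg (ν : Measure E) (m : ℕ) (x : E) : 0 ≤ rieszPotential ν m x :=
  integral_nonneg fun _ => by positivity

variable [InnerProductSpace ℝ E]

/-- The vector field `∫ |x - ζ| ^ (-m) (x - ζ) dν(ζ)`, a multiple of the gradient of the Riesz
potential of exponent `m - 2`. -/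
def rieszField (ν : Measure E) (m : ℕ) (x : E) : E :=
  ∫ ζ, (‖x - ζ‖ ^ m)⁻¹ • (x - ζ) ∂ν

variable [BorelSpace E]

theorem rieszPotential_map (ν : Measure E) (m : ℕ) (f : E ≃ₗᵢ[ℝ] E) (z : E) :
    rieszPotential (ν.map f) m (f z) = rieszPotential ν m z := by
  rw [rieszPotential, integral_map f.continuous.aemeasurable
    (Measurable.aestronglyMeasurable (by fun_prop))]
  simp only [← map_sub, f.norm_map, rieszPotential]

variable [FiniteDimensional ℝ E] {ν : Measure E} [IsFiniteMeasure ν] {x : E}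

theorem rieszPotential_pos (m : ℕ) (hν : ν ≠ 0) (hx : x ∉ ν.support) :
    0 < rieszPotential ν m x := by
  obtain ⟨δ, hδ, hfar⟩ := exists_ae_le_norm_sub hx
  refine (rieszPotential_nonneg ν m x).lt_of_ne' fun hzero => hν ?_
  rw [rieszPotential, integral_eq_zero_iff_of_nonneg (fun ζ => by positivity)
    ((isRegularKernel_inv_norm_pow m).integrable hx)] at hzero
  rw [← ae_eq_bot, ← eventually_false_iff_eq_bot]
  filter_upwards [hzero, hfar] with ζ hζ hδζ
  have : 0 < ‖x - ζ‖ := hδ.trans_le (hδζ x (mem_ball_self hδ))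
  exact (inv_pos.2 (pow_pos this m)).ne' hζ

theorem hasGradientAt_rieszPotential (m : ℕ) (hx : x ∉ ν.support) :
    HasGradientAt (rieszPotential ν m) (-(m : ℝ) • rieszField ν (m + 2) x) x := by
  let L : E →L[ℝ] StrongDual ℝ E := -(m : ℝ) • innerSL ℝ
  have hfield := isRegularKernel_inv_norm_pow_smul (E := E) (m + 1)
  have hderiv := (isRegularKernel_inv_norm_pow m).hasFDerivAt_integral (hfield.clm_comp L)
    (fun y hy => hasFDerivAt_inv_norm_pow m hy) hx
  rw [L.integral_comp_comm (hfield.integrable hx)] at hderiv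
  rw [hasGradientAt_iff_hasFDerivAt, map_smul]
  exact hderiv

theorem hasFDerivAt_rieszField (m : ℕ) (hx : x ∉ ν.support) :
    HasFDerivAt (rieszField ν (m + 1)) (∫ ζ, rieszFieldDeriv (m + 1) (x - ζ) ∂ν) x :=
  (isRegularKernel_inv_norm_pow_smul m).hasFDerivAt_integral (isRegularKernel_rieszFieldDeriv _)
    (fun _ hy => hasFDerivAt_inv_norm_pow_smul _ hy) hx

theorem contDiffAt_rieszPotential (m : ℕ) (hx : x ∉ ν.support) :
    ContDiffAt ℝ 2 (rieszPotential ν m) x := by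
  have hopen : ν.supportᶜ ∈ 𝓝 x := ν.isClosed_support.isOpen_compl.mem_nhds hx
  have hfield : ContDiffAt ℝ 1 (rieszField ν (m + 2)) x :=
    contDiffAt_one_iff.2 ⟨_, _, hopen,
      fun y hy => ((isRegularKernel_rieszFieldDeriv _).continuousAt_integral hy).continuousWithinAt,
      fun y hy => hasFDerivAt_rieszField (m + 1) hy⟩
  exact contDiffAt_succ_iff_hasFDerivAt.2 ⟨fun y => toDual ℝ E (-(m : ℝ) • rieszField ν (m + 2) y),
    ⟨_, hopen, fun y hy => (hasGradientAt_rieszPotential m hy).hasFDerivAt⟩,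
    (toDual ℝ E).toContinuousLinearEquiv.contDiff.contDiffAt.comp x (hfield.const_smul _)⟩

theorem laplacian_rieszPotential (m : ℕ) (hx : x ∉ ν.support) :
    Δ (rieszPotential ν m) x = m * (m + 2 - finrank ℝ E) * rieszPotential ν (m + 2) x := by
  let trace : (E →L[ℝ] E) →L[ℝ] ℝ :=
    (LinearMap.trace ℝ E ∘ₗ ContinuousLinearMap.coeLM ℝ).toContinuousLinearMap
  have hint := (isRegularKernel_rieszFieldDeriv (E := E) (m + 2)).integrable hx
  have hgrad := (ν.isClosed_support.isOpen_compl.eventually_mem hx).mono fun y hy =>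
    hasGradientAt_rieszPotential m hy
  have htrace : trace (∫ ζ, rieszFieldDeriv (m + 2) (x - ζ) ∂ν) =
      (finrank ℝ E - (m + 2)) * rieszPotential ν (m + 2) x := by
    rw [← trace.integral_comp_comm hint, rieszPotential, ← integral_const_mul]
    refine integral_congr_ae ?_
    obtain ⟨δ, hδ, hfar⟩ := exists_ae_le_norm_sub hx
    filter_upwards [hfar] with ζ hζ
    have hne := norm_pos_iff.1 (hδ.trans_le (hζ x (mem_ball_self hδ)))
    exact_mod_cast trace_rieszFieldDeriv (m + 2) hne
  rw [laplacian_eq_trace hgrad ((hasFDerivAt_rieszField (m + 1) hx).const_smul _),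
    ContinuousLinearMap.toLinearMap_smul, map_smul]
  change -(m : ℝ) • trace _ = _
  rw [htrace, smul_eq_mul]
  ring

end RieszPotential

section Sphere

variable {E : Type*} [NormedAddCommGroup E] [InnerProductSpace ℝ E] [FiniteDimensional ℝ E]
  [MeasurableSpace E] [BorelSpace E]

variable (E) in
/-- The surface measure of the unit sphere, as a measure on the ambient space. -/
def surfaceMeasure : Measure E :=
  (volume : Measure E).toSphere.map Subtype.val

instance : IsFiniteMeasure (surfaceMeasure E) := by
  unfold surfaceMeasure
  infer_instance

theorem surfaceMeasure_real_univ :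
    (surfaceMeasure E).real univ = (volume : Measure E).toSphere.real univ := by
  rw [surfaceMeasure, map_measureReal_apply (by fun_prop) .univ, preimage_univ]

theorem surfaceMeasure_real_univ_pos [Nontrivial E] : 0 < (surfaceMeasure E).real univ := by
  have hball : 0 < (volume : Measure E).real (ball 0 1) :=
    ENNReal.toReal_pos (measure_ball_pos _ _ one_pos).ne' measure_ball_lt_top.ne
  rw [surfaceMeasure_real_univ, Measure.toSphere_real_apply_univ]
  have := finrank_pos (R := ℝ) (M := E)
  positivity

theorem ae_surfaceMeasure_norm : ∀ᵐ ω ∂surfaceMeasure E, ‖ω‖ = 1 := by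
  unfold surfaceMeasure
  rw [ae_map_iff (by fun_prop) (measurableSet_eq_fun (by fun_prop) (by fun_prop))]
  exact .of_forall fun ω => by simp

theorem notMem_support_surfaceMeasure {z : E} (hz : ‖z‖ < 1) : z ∉ (surfaceMeasure E).support := by
  rw [Measure.notMem_support_iff_exists]
  refine ⟨ball 0 1, isOpen_ball.mem_nhds (by simpa), ?_⟩
  rw [measure_eq_zero_iff_ae_notMem]
  filter_upwards [ae_surfaceMeasure_norm] with ω hω
  simp [hω]

theorem map_surfaceMeasure (f : E ≃ₗᵢ[ℝ] E) : (surfaceMeasure E).map f = surfaceMeasure E := by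
  ext s hs
  have hf : Measurable f := f.continuous.measurable
  have hcone : Ioo (0 : ℝ) 1 • ((Subtype.val : sphere (0 : E) 1 → E) ''
        (Subtype.val ⁻¹' (f ⁻¹' s))) =
      f.toMeasurableEquiv ⁻¹' (Ioo (0 : ℝ) 1 • ((Subtype.val : sphere (0 : E) 1 → E) ''
        (Subtype.val ⁻¹' s))) := by
    ext y
    simp only [Subtype.image_preimage_coe, Set.mem_smul, mem_inter_iff, mem_preimage,
      mem_sphere_zero_iff_norm]
    constructor
    · rintro ⟨r, hr, ω, ⟨hω, hωs⟩, rfl⟩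
      exact ⟨r, hr, f ω, ⟨by simpa using hω, hωs⟩, by simp⟩
    · rintro ⟨r, hr, ω, ⟨hω, hωs⟩, hy⟩
      refine ⟨r, hr, f.symm ω, ⟨by simpa using hω, by simpa using hωs⟩, ?_⟩
      rw [← map_smul, hy]
      simp
  rw [Measure.map_apply hf hs, surfaceMeasure, Measure.map_apply (by fun_prop) (hf hs),
    Measure.map_apply (by fun_prop) hs,
    Measure.toSphere_apply' _ (measurable_subtype_coe (hf hs)),
    Measure.toSphere_apply' _ (measurable_subtype_coe hs), hcone,
    f.measurePreserving.measure_preimage_equiv]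

theorem rieszPotential_surfaceMeasure_congr (m : ℕ) {z z' : E} (h : ‖z‖ = ‖z'‖) :
    rieszPotential (surfaceMeasure E) m z = rieszPotential (surfaceMeasure E) m z' := by
  have := rieszPotential_map (surfaceMeasure E) m (Submodule.reflection (ℝ ∙ (z - z'))ᗮ) z
  rw [map_surfaceMeasure, Submodule.reflection_sub h] at this
  exact this.symm

theorem two_mul_inner_rieszField_surfaceMeasure (m : ℕ) {z : E} (hz : ‖z‖ < 1) :
    2 * inner ℝ z (rieszField (surfaceMeasure E) (m + 2) z) =
      rieszPotential (surfaceMeasure E) m z -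
        (1 - ‖z‖ ^ 2) * rieszPotential (surfaceMeasure E) (m + 2) z := by
  have hz' := notMem_support_surfaceMeasure hz
  have hpot (j : ℕ) := (isRegularKernel_inv_norm_pow (E := E) j).integrable hz'
  rw [rieszField, ← integral_inner ((isRegularKernel_inv_norm_pow_smul (m + 1)).integrable hz'),
    ← integral_const_mul, rieszPotential, rieszPotential, ← integral_const_mul,
    ← integral_sub (hpot m) ((hpot _).const_mul _)]
  refine integral_congr_ae ?_
  filter_upwards [ae_surfaceMeasure_norm] with ω hω
  have hne : ‖z - ω‖ ≠ 0 := by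
    rw [norm_ne_zero_iff, sub_ne_zero]
    rintro rfl
    exact hz.ne hω
  have hinner : 2 * inner ℝ z (z - ω) = ‖z‖ ^ 2 + ‖z - ω‖ ^ 2 - 1 := by
    have := norm_sub_sq_real z (z - ω)
    rw [sub_sub_cancel, hω] at this
    linarith
  rw [inner_smul_right, mul_left_comm, hinner]
  field_simp
  ring

theorem harmonicOnNhd_poisson :
    HarmonicOnNhd (fun z => (1 - ‖z‖ ^ 2) * rieszPotential (surfaceMeasure E) (finrank ℝ E) z)
      (ball 0 1) := by
  have hnorm (z : E) : ContDiffAt ℝ 2 (fun y : E => 1 - ‖y‖ ^ 2) z :=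
    contDiffAt_const.sub (contDiff_norm_sq ℝ).contDiffAt
  have hpot {z : E} (hz : z ∈ ball (0 : E) 1) := contDiffAt_rieszPotential (finrank ℝ E)
    (notMem_support_surfaceMeasure (mem_ball_zero_iff.1 hz))
  refine fun z hz => ⟨(hnorm z).mul (hpot hz), ?_⟩
  filter_upwards [isOpen_ball.mem_nhds hz] with y hy
  have hy' := mem_ball_zero_iff.1 hy
  have hgrad (y : E) : HasGradientAt (fun y : E => 1 - ‖y‖ ^ 2) ((-2 : ℝ) • y) y := by
    rw [hasGradientAt_iff_hasFDerivAt, neg_smul, map_neg]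
    exact (hasGradientAt_norm_sq y).hasFDerivAt.const_sub 1
  have hΔ : Δ (fun y : E => (1 : ℝ) - ‖y‖ ^ 2) y = -(2 * finrank ℝ E : ℝ) := by
    rw [laplacian_eq_trace (.of_forall hgrad) ((hasFDerivAt_id y).const_smul (-2 : ℝ))]
    simp
  rw [laplacian_mul (hnorm y) (hpot hy), (hgrad y).gradient, hΔ,
    (hasGradientAt_rieszPotential _ (notMem_support_surfaceMeasure hy')).gradient,
    laplacian_rieszPotential _ (notMem_support_surfaceMeasure hy'), real_inner_smul_left,
    real_inner_smul_right, Pi.zero_apply]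
  linear_combination
    (2 * finrank ℝ E : ℝ) * two_mul_inner_rieszField_surfaceMeasure (finrank ℝ E) hy'

theorem rieszPotential_surfaceMeasure_zero (m : ℕ) :
    rieszPotential (surfaceMeasure E) m 0 = (surfaceMeasure E).real univ := by
  have hone : (fun ω : E => (‖0 - ω‖ ^ m)⁻¹) =ᵐ[surfaceMeasure E] fun _ => 1 := by
    filter_upwards [ae_surfaceMeasure_norm] with ω hω
    simp [hω]
  rw [rieszPotential, integral_congr_ae hone]
  simp

theorem integral_surfaceMeasure_inv_norm_add_pow (m : ℕ) {e : E} (s : ℝ) (he : ‖e‖ = 1) :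
    ∫ ω, (‖e + s • ω‖ ^ m)⁻¹ ∂surfaceMeasure E = rieszPotential (surfaceMeasure E) m (s • e) := by
  rw [rieszPotential_surfaceMeasure_congr m (norm_neg (s • e)).symm, rieszPotential]
  refine integral_congr_ae ?_
  filter_upwards [ae_surfaceMeasure_norm] with ω hω
  congr 2
  rw [← norm_neg (-(s • e) - ω), neg_sub, sub_neg_eq_add, ← sq_eq_sq₀ (norm_nonneg _)
    (norm_nonneg _), norm_add_sq_real, norm_add_sq_real, norm_smul, norm_smul, he, hω,
    real_inner_smul_right, real_inner_smul_right, real_inner_comm]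

variable [Nontrivial E] {z : E}

theorem rieszPotential_surfaceMeasure (hz : ‖z‖ < 1) :
    rieszPotential (surfaceMeasure E) (finrank ℝ E) z =
      (surfaceMeasure E).real univ / (1 - ‖z‖ ^ 2) := by
  have hpos : 0 < 1 - ‖z‖ ^ 2 := by nlinarith [norm_nonneg z]
  rw [eq_div_iff hpos.ne', mul_comm]
  rcases eq_or_ne z 0 with rfl | hz0
  · simp [rieszPotential_surfaceMeasure_zero]
  have hsub : closedBall (0 : E) ‖z‖ ⊆ ball 0 1 := closedBall_subset_ball hz
  have hradial : ∀ y ∈ frontier (closedBall (0 : E) ‖z‖),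
      (1 - ‖y‖ ^ 2) * rieszPotential (surfaceMeasure E) (finrank ℝ E) y =
        (1 - ‖z‖ ^ 2) * rieszPotential (surfaceMeasure E) (finrank ℝ E) z := fun y hy => by
    rw [frontier_closedBall _ (norm_ne_zero_iff.2 hz0), mem_sphere_zero_iff_norm] at hy
    rw [hy, rieszPotential_surfaceMeasure_congr _ hy]
  have := eq_of_harmonicOnNhd (isCompact_closedBall 0 ‖z‖)
    (harmonicOnNhd_poisson.continuousOn.mono hsub)
    (harmonicOnNhd_poisson.mono (interior_subset.trans hsub)) hradial 0
    (mem_closedBall_self (norm_nonneg z))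
  rw [← this]
  simp [rieszPotential_surfaceMeasure_zero]

theorem rieszField_surfaceMeasure (hz : ‖z‖ < 1) :
    rieszField (surfaceMeasure E) (finrank ℝ E + 2) z =
      -(2 * (surfaceMeasure E).real univ / (finrank ℝ E * (1 - ‖z‖ ^ 2) ^ 2)) • z := by
  have hpos : 1 - ‖z‖ ^ 2 ≠ 0 := by nlinarith [norm_nonneg z]
  have hn : (finrank ℝ E : ℝ) ≠ 0 := by exact_mod_cast finrank_pos.ne'
  have hgrad := hasGradientAt_rieszPotential (finrank ℝ E) (notMem_support_surfaceMeasure hz)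
  have hgrad' : HasGradientAt (fun y : E => (surfaceMeasure E).real univ / (1 - ‖y‖ ^ 2))
      ((2 * (surfaceMeasure E).real univ / (1 - ‖z‖ ^ 2) ^ 2) • z) z := by
    have hdiv : HasDerivAt (fun t => (surfaceMeasure E).real univ / (1 - t))
        ((surfaceMeasure E).real univ / (1 - ‖z‖ ^ 2) ^ 2) (‖z‖ ^ 2) :=
      ((hasDerivAt_const _ _).div ((hasDerivAt_id _).const_sub 1) hpos).congr_deriv (by simp)
    have := hdiv.comp_hasFDerivAt z (hasGradientAt_norm_sq z).hasFDerivAt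
    rw [hasGradientAt_iff_hasFDerivAt]
    refine this.congr_fderiv ?_
    rw [← map_smul, smul_smul]
    congr 2
    ring
  have heq : rieszPotential (surfaceMeasure E) (finrank ℝ E) =ᶠ[𝓝 z]
      fun y => (surfaceMeasure E).real univ / (1 - ‖y‖ ^ 2) := by
    filter_upwards [continuous_norm.continuousAt.eventually_lt_const hz] with y hy
    exact rieszPotential_surfaceMeasure hy
  refine smul_right_injective E (neg_ne_zero.2 hn) ?_
  refine (hgrad.unique (hgrad'.congr_of_eventuallyEq heq)).trans ?_
  simp only [smul_smul]
  congr 1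
  field_simp

theorem rieszPotential_surfaceMeasure_add_two (hz : ‖z‖ < 1) :
    rieszPotential (surfaceMeasure E) (finrank ℝ E + 2) z = (surfaceMeasure E).real univ *
      (1 / (1 - ‖z‖ ^ 2) ^ 2 + 4 * ‖z‖ ^ 2 / (finrank ℝ E * (1 - ‖z‖ ^ 2) ^ 3)) := by
  have hpos : 1 - ‖z‖ ^ 2 ≠ 0 := by nlinarith [norm_nonneg z]
  have hn : (finrank ℝ E : ℝ) ≠ 0 := by exact_mod_cast finrank_pos.ne'
  have h := two_mul_inner_rieszField_surfaceMeasure (finrank ℝ E) hz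
  rw [rieszField_surfaceMeasure hz, real_inner_smul_right, real_inner_self_eq_norm_sq,
    rieszPotential_surfaceMeasure hz] at h
  refine mul_left_cancel₀ hpos ?_
  rw [eq_sub_iff_add_eq, ← eq_sub_iff_add_eq'] at h
  rw [h]
  field_simp
  ring

end Sphere

/-- The kernel `(t² |c|² - |y - c|²) / |y| ^ (n + 2)`, nonnegative on the ball of radius
`t |c|` around `c` and nonpositive off it. Expanding the square, its integral compares the component
of `rieszField` along `c` with the Riesz potentials of exponents `n` and `n + 2`. -/
def extremalKernel {E : Type*} [NormedAddCommGroup E] (n : ℕ) (c : E) (t : ℝ) (y : E) : ℝ :=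
  ((t * ‖c‖) ^ 2 - ‖y - c‖ ^ 2) * (‖y‖ ^ (n + 2))⁻¹

section Ball

variable {E : Type*} [NormedAddCommGroup E] [InnerProductSpace ℝ E] [FiniteDimensional ℝ E]
  [MeasurableSpace E] [BorelSpace E] [Nontrivial E]

theorem integral_eq_setIntegral_Ioi_polar {G : Type*} [NormedAddCommGroup G] [NormedSpace ℝ G]
    {f : E → G} (hf : Integrable f) :
    ∫ x, f x = ∫ s in Ioi (0 : ℝ), s ^ (finrank ℝ E - 1) • ∫ ω, f (s • ω) ∂surfaceMeasure E := by
  have hmp := (volume : Measure E).measurePreserving_homeomorphUnitSphereProd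
  have hemb := (homeomorphUnitSphereProd E).measurableEmbedding
  let g : sphere (0 : E) 1 × Ioi (0 : ℝ) → G := fun p => f (p.2.1 • p.1.1)
  have hcomp (x : ({0}ᶜ : Set E)) : g (homeomorphUnitSphereProd E x) = f x := by
    simp [g, smul_inv_smul₀ (norm_ne_zero_iff.2 x.2)]
  have hg : Integrable g
      ((volume : Measure E).toSphere.prod (.volumeIoiPow (finrank ℝ E - 1))) := by
    rw [← hmp.integrable_comp_emb hemb, Function.comp_def]
    simp only [hcomp]
    exact (integrableOn_iff_comap_subtypeVal (measurableSet_singleton _).compl).1 hf.integrableOn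
  calc ∫ x, f x
      = ∫ x : ({0}ᶜ : Set E), f x ∂(volume.comap Subtype.val) := by
        rw [integral_subtype_comap (measurableSet_singleton _).compl fun x => f x,
          restrict_compl_singleton]
    _ = ∫ p, g p ∂(volume : Measure E).toSphere.prod (.volumeIoiPow (finrank ℝ E - 1)) := by
        rw [← hmp.integral_comp hemb]
        simp only [hcomp]
    _ = ∫ s : Ioi (0 : ℝ), ∫ ω, f (s.1 • ω) ∂surfaceMeasure E
          ∂.volumeIoiPow (finrank ℝ E - 1) := by
        rw [integral_prod_symm _ hg]
        refine integral_congr_ae (.of_forall fun s => ?_)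
        exact ((MeasurableEmbedding.subtype_coe isClosed_sphere.measurableSet).integral_map
          fun ω => f (s.1 • ω)).symm
    _ = _ := by
        rw [Measure.volumeIoiPow, integral_withDensity_eq_integral_toReal_smul (by fun_prop)
            (.of_forall fun _ => ENNReal.ofReal_lt_top), ← integral_subtype_comap measurableSet_Ioi
            fun s : ℝ => s ^ (finrank ℝ E - 1) • ∫ ω, f (s • ω) ∂surfaceMeasure E]
        refine integral_congr_ae (.of_forall fun s => ?_)
        simp only [ENNReal.toReal_ofReal (pow_nonneg s.2.le _)]

theorem setIntegral_ball_zero_eq_polar {G : Type*} [NormedAddCommGroup G] [NormedSpace ℝ G]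
    {f : E → G} {t : ℝ} (ht : 0 ≤ t) (hf : IntegrableOn f (ball 0 t)) :
    ∫ x in ball 0 t, f x =
      ∫ s in 0..t, s ^ (finrank ℝ E - 1) • ∫ ω, f (s • ω) ∂surfaceMeasure E := by
  rw [← integral_indicator measurableSet_ball, integral_eq_setIntegral_Ioi_polar
    (hf.integrable_indicator measurableSet_ball), intervalIntegral.integral_of_le ht,
    integral_Ioc_eq_integral_Ioo, ← Ioi_inter_Iio, ← setIntegral_indicator measurableSet_Iio]
  refine setIntegral_congr_fun measurableSet_Ioi fun s (hs : 0 < s) => ?_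
  have hsphere : (fun ω => (ball 0 t).indicator f (s • ω)) =ᵐ[surfaceMeasure E]
      fun ω => (Iio t).indicator (fun r => f (r • ω)) s := by
    filter_upwards [ae_surfaceMeasure_norm] with ω hω
    simp [indicator, norm_smul, hω, abs_of_pos hs]
  rw [integral_congr_ae hsphere]
  by_cases hst : s < t <;> simp [hst]

variable {e : E} {t : ℝ}

theorem setIntegral_ball_eq_integral_rieszPotential {g : ℝ → ℝ} (hg : Continuous g) (m : ℕ)
    (he : ‖e‖ = 1) (ht0 : 0 ≤ t) (ht1 : t < 1) :
    ∫ y in ball e t, g ‖y - e‖ * (‖y‖ ^ m)⁻¹ =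
      ∫ s in 0..t, s ^ (finrank ℝ E - 1) * (g s * rieszPotential (surfaceMeasure E) m (s • e)) := by
  have hne : ∀ z ∈ closedBall (0 : E) t, ‖e + z‖ ^ m ≠ 0 := fun z hz => by
    have hz' : ‖z‖ < 1 := (mem_closedBall_zero_iff.1 hz).trans_lt ht1
    refine pow_ne_zero m (norm_ne_zero_iff.2 fun h => ?_)
    rw [add_eq_zero_iff_eq_neg] at h
    rw [h, norm_neg] at he
    exact hz'.ne he
  have hint : IntegrableOn (fun z => g ‖z‖ * (‖e + z‖ ^ m)⁻¹) (ball 0 t) := by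
    have hcont : ContinuousOn (fun z => g ‖z‖ * (‖e + z‖ ^ m)⁻¹) (closedBall 0 t) :=
      ContinuousOn.mul (by fun_prop) (ContinuousOn.inv₀ (by fun_prop) hne)
    exact (hcont.integrableOn_compact (isCompact_closedBall _ _)).mono_set ball_subset_closedBall
  have hshift : (e + ·) ⁻¹' ball e t = ball 0 t := by
    ext z
    simp
  rw [← (measurePreserving_add_left volume e).setIntegral_preimage_emb
    (measurableEmbedding_addLeft e), hshift]
  simp only [add_sub_cancel_left]
  rw [setIntegral_ball_zero_eq_polar ht0 hint]
  refine intervalIntegral.integral_congr fun s hs => ?_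
  rw [uIcc_of_le ht0] at hs
  have hsphere : (fun ω => g ‖s • ω‖ * (‖e + s • ω‖ ^ m)⁻¹) =ᵐ[surfaceMeasure E]
      fun ω => g s * (‖e + s • ω‖ ^ m)⁻¹ := by
    filter_upwards [ae_surfaceMeasure_norm] with ω hω
    rw [norm_smul, hω, mul_one, Real.norm_of_nonneg hs.1]
  simp only [smul_eq_mul]
  rw [integral_congr_ae hsphere, integral_const_mul,
    integral_surfaceMeasure_inv_norm_add_pow m s he]

theorem hasDerivAt_extremalRadial {n : ℕ} (hn : n ≠ 0) {s : ℝ} (hs : 1 - s ^ 2 ≠ 0) :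
    HasDerivAt (fun s => (2 * s ^ n / (1 - s ^ 2) - (1 - t ^ 2) * (s ^ n / (1 - s ^ 2) ^ 2)) / n)
      (s ^ (n - 1) / (1 - s ^ 2) + s ^ (n - 1) * ((t ^ 2 - s ^ 2) *
        (1 / (1 - s ^ 2) ^ 2 + 4 * s ^ 2 / (n * (1 - s ^ 2) ^ 3)))) s := by
  have hden : HasDerivAt (fun s : ℝ => 1 - s ^ 2) (-(2 * s)) s := by
    simpa using (hasDerivAt_pow 2 s).const_sub 1
  have hpow : HasDerivAt (fun s : ℝ => s ^ n) (n * s ^ (n - 1)) s := hasDerivAt_pow n s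
  refine ((((hpow.const_mul 2).div hden hs).sub ((hpow.div (hden.pow 2)
    (pow_ne_zero 2 hs)).const_mul (1 - t ^ 2))).div_const (n : ℝ)).congr_deriv ?_
  obtain ⟨k, rfl⟩ := Nat.exists_eq_add_one_of_ne_zero hn
  simp only [Nat.add_sub_cancel, Pi.pow_apply]
  field_simp
  ring

theorem integral_extremalRadial {n : ℕ} (hn : n ≠ 0) (ht0 : 0 ≤ t) (ht1 : t < 1) :
    ∫ s in 0..t, s ^ (n - 1) * ((t ^ 2 - s ^ 2) *
        (1 / (1 - s ^ 2) ^ 2 + 4 * s ^ 2 / (n * (1 - s ^ 2) ^ 3))) =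
      t ^ n / (n * (1 - t ^ 2)) - ∫ s in 0..t, s ^ (n - 1) / (1 - s ^ 2) := by
  have hden : ∀ s ∈ uIcc 0 t, 1 - s ^ 2 ≠ 0 := fun s hs => by
    rw [uIcc_of_le ht0] at hs
    nlinarith [hs.1, hs.2]
  have hden2 : ∀ s ∈ uIcc 0 t, (1 - s ^ 2) ^ 2 ≠ 0 := fun s hs => pow_ne_zero 2 (hden s hs)
  have hden3 : ∀ s ∈ uIcc 0 t, n * (1 - s ^ 2) ^ 3 ≠ 0 := fun s hs =>
    mul_ne_zero (Nat.cast_ne_zero.2 hn) (pow_ne_zero 3 (hden s hs))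
  have hint : IntervalIntegrable (fun s => s ^ (n - 1) / (1 - s ^ 2)) volume 0 t :=
    ContinuousOn.intervalIntegrable (by fun_prop (disch := assumption))
  have hint' : IntervalIntegrable (fun s => s ^ (n - 1) * ((t ^ 2 - s ^ 2) *
      (1 / (1 - s ^ 2) ^ 2 + 4 * s ^ 2 / (n * (1 - s ^ 2) ^ 3)))) volume 0 t :=
    ContinuousOn.intervalIntegrable (by fun_prop (disch := assumption))
  rw [eq_sub_iff_add_eq', ← intervalIntegral.integral_add hint hint',
    intervalIntegral.integral_eq_sub_of_hasDerivAt
      (fun s hs => hasDerivAt_extremalRadial hn (hden s hs)) (hint.add hint')]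
  have := hden t right_mem_uIcc
  simp only [zero_pow hn]
  field_simp
  ring

theorem setIntegral_ball_extremalKernel_of_norm_eq_one (he : ‖e‖ = 1) (ht0 : 0 ≤ t) (ht1 : t < 1) :
    ∫ y in ball e t, extremalKernel (finrank ℝ E) e t y =
      (surfaceMeasure E).real univ * (t ^ finrank ℝ E / (finrank ℝ E * (1 - t ^ 2)) -
        ∫ s in 0..t, s ^ (finrank ℝ E - 1) / (1 - s ^ 2)) := by
  simp only [extremalKernel, he, mul_one]
  rw [setIntegral_ball_eq_integral_rieszPotential (g := fun s => t ^ 2 - s ^ 2) (by fun_prop) _ he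
    ht0 ht1, ← integral_extremalRadial finrank_pos.ne' ht0 ht1,
    ← intervalIntegral.integral_const_mul]
  refine intervalIntegral.integral_congr fun s hs => ?_
  rw [uIcc_of_le ht0] at hs
  have hnorm : ‖s • e‖ = s := by rw [norm_smul, he, mul_one, Real.norm_of_nonneg hs.1]
  rw [rieszPotential_surfaceMeasure_add_two (by rw [hnorm]; exact hs.2.trans_lt ht1), hnorm]
  ring

theorem setIntegral_ball_extremalKernel {c : E} (hc : c ≠ 0) (ht0 : 0 ≤ t) (ht1 : t < 1) :
    ∫ y in ball c (t * ‖c‖), extremalKernel (finrank ℝ E) c t y =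
      (surfaceMeasure E).real univ * (t ^ finrank ℝ E / (finrank ℝ E * (1 - t ^ 2)) -
        ∫ s in 0..t, s ^ (finrank ℝ E - 1) / (1 - s ^ 2)) := by
  have hc' : 0 < ‖c‖ := norm_pos_iff.2 hc
  obtain ⟨e, he, hce⟩ : ∃ e : E, ‖e‖ = 1 ∧ ‖c‖ • e = c :=
    ⟨‖c‖⁻¹ • c, norm_smul_inv_norm (𝕜 := ℝ) hc, smul_inv_smul₀ hc'.ne' c⟩
  have hball : ball c (t * ‖c‖) = ‖c‖ • ball e t := by
    rw [_root_.smul_ball hc'.ne', hce, norm_norm, mul_comm]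
  rw [← setIntegral_ball_extremalKernel_of_norm_eq_one he ht0 ht1, hball,
    ← smul_inv_smul₀ (pow_pos hc' _).ne' (∫ y in ‖c‖ • ball e t, _),
      ← Measure.setIntegral_comp_smul_of_pos _ _ _ hc', ← integral_smul]
  refine integral_congr_ae (.of_forall fun y => ?_)
  have hsub : ‖‖c‖ • y - c‖ = ‖c‖ * ‖y - e‖ := by
    nth_rw 2 [← hce]
    rw [← smul_sub, norm_smul, norm_norm]
  simp only [extremalKernel, he, hsub, norm_smul, norm_norm, smul_eq_mul, mul_pow]
  field_simp
  ring

end Ball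

section OneDimensional

variable {n : ℕ} {s t α : ℝ}

theorem mul_pow_le_add_mul_pow (k : ℕ) (hs : 0 ≤ s) :
    (2 * k + 2) * s ^ k ≤ (k + 2) + k * s ^ (2 * k + 2) := by
  have hamgm := Real.geom_mean_le_arith_mean2_weighted (w₁ := (k + 2) / (2 * k + 2))
    (w₂ := k / (2 * k + 2)) (p₁ := 1) (p₂ := s ^ (2 * k + 2)) (by positivity) (by positivity)
    zero_le_one (by positivity) (by field_simp; ring)
  have hexp : ((2 * k + 2 : ℕ) : ℝ) * (k / (2 * k + 2)) = k := by
    push_cast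
    field_simp
  rw [Real.one_rpow, one_mul, ← Real.rpow_natCast, ← Real.rpow_mul hs, hexp, Real.rpow_natCast,
    Real.rpow_natCast] at hamgm
  calc (2 * k + 2) * s ^ k
      ≤ (2 * k + 2) * ((k + 2) / (2 * k + 2) * 1 + k / (2 * k + 2) * s ^ (2 * k + 2)) := by gcongr
    _ = (k + 2) + k * s ^ (2 * k + 2) := by field_simp

theorem one_sub_sq_le_mul (hn : 2 ≤ n) (hs : 0 ≤ s) :
    1 - s ^ 2 ≤ (1 - s ^ n) * (1 - (1 - 2 / (n : ℝ)) * s ^ n) := by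
  obtain ⟨k, rfl⟩ := Nat.exists_eq_add_of_le' hn
  have hdiff : (1 - s ^ (k + 2)) * (1 - (1 - 2 / ((k + 2 : ℕ) : ℝ)) * s ^ (k + 2)) - (1 - s ^ 2) =
      s ^ 2 * ((k + 2) + k * s ^ (2 * k + 2) - (2 * k + 2) * s ^ k) / (k + 2) := by
    push_cast
    field_simp
    ring
  rw [← sub_nonneg, hdiff]
  have := sub_nonneg.2 (mul_pow_le_add_mul_pow k hs)
  positivity

theorem hasDerivAt_log_sub_log (h₁ : 1 - s ^ n ≠ 0) (hα : 1 - α * s ^ n ≠ 0) :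
    HasDerivAt (fun s => Real.log (1 - α * s ^ n) - Real.log (1 - s ^ n))
      (n * (1 - α) * (s ^ (n - 1) / ((1 - s ^ n) * (1 - α * s ^ n)))) s := by
  have hpow : HasDerivAt (fun s : ℝ => s ^ n) (n * s ^ (n - 1)) s := hasDerivAt_pow n s
  refine ((((hpow.const_mul α).const_sub 1).log hα).sub
    ((hpow.const_sub 1).log h₁)).congr_deriv ?_
  field_simp
  ring

theorem log_le_two_mul_integral (hn : 2 ≤ n) (ht0 : 0 ≤ t) (ht1 : t < 1) :
    Real.log ((1 - (1 - 2 / (n : ℝ)) * t ^ n) / (1 - t ^ n)) ≤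
      2 * ∫ s in 0..t, s ^ (n - 1) / (1 - s ^ 2) := by
  have hn0 : n ≠ 0 := by omega
  set α : ℝ := 1 - 2 / n with hα
  have hα1 : α ≤ 1 := sub_le_self 1 (by positivity)
  have hnα : n * (1 - α) = 2 := by
    rw [hα]
    field_simp
    ring
  have hone : ∀ s ∈ Icc 0 t, 0 < 1 - s ^ n := fun s hs =>
    sub_pos.2 (pow_lt_one₀ hs.1 (hs.2.trans_lt ht1) hn0)
  have hpos : ∀ s ∈ Icc 0 t, 0 < 1 - α * s ^ n := fun s hs =>
    (hone s hs).trans_le (sub_le_sub_left (mul_le_of_le_one_left (pow_nonneg hs.1 n) hα1) 1)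
  have hsq : ∀ s ∈ Icc 0 t, 0 < 1 - s ^ 2 := fun s hs => by nlinarith [hs.1, hs.2]
  have hderiv : ∀ s ∈ Icc 0 t, _ := fun s hs =>
    hasDerivAt_log_sub_log (α := α) (hone s hs).ne' (hpos s hs).ne'
  have hcont : ContinuousOn (fun s : ℝ => 2 * (s ^ (n - 1) / (1 - s ^ 2))) (Icc 0 t) :=
    continuousOn_const.mul (ContinuousOn.div (by fun_prop) (by fun_prop) fun s hs => (hsq s hs).ne')
  have hle := intervalIntegral.sub_le_integral_of_hasDeriv_right_of_le ht0
    (fun s hs => (hderiv s hs).continuousAt.continuousWithinAt)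
    (fun s hs => (hderiv s (Ioo_subset_Icc_self hs)).hasDerivWithinAt)
    (hcont.integrableOn_compact isCompact_Icc) fun s hs => by
      rw [hnα]
      have hs' := Ioo_subset_Icc_self hs
      have := hsq s hs'
      have := pow_nonneg hs'.1 (n - 1)
      gcongr
      exact one_sub_sq_le_mul hn hs'.1
  rw [intervalIntegral.integral_const_mul] at hle
  rw [Real.log_div (hpos t ⟨ht0, le_rfl⟩).ne' (hone t ⟨ht0, le_rfl⟩).ne']
  simpa [hn0] using hle

theorem exists_pow_mul_eq_one_sub_exp_neg (hn : 2 ≤ n) {v : ℝ} (hv : 0 < v) :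
    ∃ t : ℝ, 0 ≤ t ∧ t < 1 ∧
      t ^ n * (1 - (1 - 2 / (n : ℝ)) * Real.exp (-v)) = 1 - Real.exp (-v) ∧
      v ≤ 2 * ∫ s in 0..t, s ^ (n - 1) / (1 - s ^ 2) := by
  set α : ℝ := 1 - 2 / n with hα
  set ε := Real.exp (-v) with hε
  have hα1 : 0 < 1 - α := by
    rw [hα, sub_sub_cancel]
    positivity
  have hε0 : 0 < ε := Real.exp_pos _
  have hε1 : 0 < 1 - ε := by simpa [hε] using hv
  have hden : 0 < 1 - α * ε := by nlinarith
  set q := (1 - ε) / (1 - α * ε) with hq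
  have hq0 : 0 ≤ q := by positivity
  have hq1 : q < 1 := by
    rw [hq, div_lt_one hden]
    nlinarith
  have htn : (q ^ (n : ℝ)⁻¹) ^ n = q := Real.rpow_inv_natCast_pow hq0 (by omega)
  have ht0 : 0 ≤ q ^ (n : ℝ)⁻¹ := by positivity
  have ht1 : q ^ (n : ℝ)⁻¹ < 1 := Real.rpow_lt_one hq0 hq1 (by positivity)
  refine ⟨q ^ (n : ℝ)⁻¹, ht0, ht1, by rw [htn, hq, div_mul_cancel₀ _ hden.ne'], ?_⟩
  have hratio : (1 - α * q) / (1 - q) = Real.exp v := by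
    have hqD : q * (1 - α * ε) = 1 - ε := div_mul_cancel₀ _ hden.ne'
    have hsub : 1 - q = (1 - α) * ε / (1 - α * ε) := by
      rw [eq_div_iff hden.ne']
      linear_combination -hqD
    have hsub' : 1 - α * q = (1 - α) / (1 - α * ε) := by
      rw [eq_div_iff hden.ne']
      linear_combination -α * hqD
    rw [hsub, hsub', ← inv_inv (Real.exp v), ← Real.exp_neg, ← hε]
    field_simp
  simpa only [htn, ← hα, hratio, Real.log_exp] using log_le_two_mul_integral hn ht0 ht1

end OneDimensional

theorem integral_le_setIntegral_of_measure_le {α : Type*} [MeasurableSpace α] {μ ν : Measure α}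
    (hνμ : ν ≤ μ) {s : Set α} (hs : MeasurableSet s) {f : α → ℝ} (hfν : Integrable f ν)
    (hfμ : IntegrableOn f s μ) (hpos : ∀ y ∈ s, 0 ≤ f y) (hneg : ∀ y ∉ s, f y ≤ 0) :
    ∫ y, f y ∂ν ≤ ∫ y in s, f y ∂μ := by
  calc ∫ y, f y ∂ν
      ≤ ∫ y, s.indicator f y ∂ν :=
        integral_mono hfν (hfν.indicator hs) (le_indicator (fun _ _ => le_rfl) hneg)
    _ = ∫ y in s, f y ∂ν := integral_indicator hs
    _ ≤ ∫ y in s, f y ∂μ :=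
        integral_mono_measure (Measure.restrict_mono subset_rfl hνμ)
          ((ae_restrict_mem hs).mono hpos) hfμ

theorem extremalKernel_eq {E : Type*} [NormedAddCommGroup E] [InnerProductSpace ℝ E] (n : ℕ) (c : E)
    (t : ℝ) {y : E} (hy : y ≠ 0) :
    extremalKernel n c t y =
      2 * inner ℝ c ((‖y‖ ^ (n + 2))⁻¹ • y) - (1 - t ^ 2) * ‖c‖ ^ 2 * (‖y‖ ^ (n + 2))⁻¹ -
        (‖y‖ ^ n)⁻¹ := by
  have : ‖y‖ ≠ 0 := norm_ne_zero_iff.2 hy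
  rw [extremalKernel, norm_sub_sq_real, inner_smul_right, real_inner_comm]
  field_simp
  ring

section FieldInequality

variable {E : Type*} [NormedAddCommGroup E] [InnerProductSpace ℝ E] [FiniteDimensional ℝ E]
  [MeasurableSpace E] [BorelSpace E] {ν : Measure E} [IsFiniteMeasure ν] {x : E}

theorem integrable_and_integral_extremalKernel (n : ℕ) (c : E) (t : ℝ) (hx : x ∉ ν.support) :
    Integrable (fun ζ => extremalKernel n c t (x - ζ)) ν ∧
    ∫ ζ, extremalKernel n c t (x - ζ) ∂ν =
      2 * inner ℝ c (rieszField ν (n + 2) x) - (1 - t ^ 2) * ‖c‖ ^ 2 * rieszPotential ν (n + 2) x -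
        rieszPotential ν n x := by
  have hpot (m : ℕ) := (isRegularKernel_inv_norm_pow (E := E) m).integrable hx
  have hfield : Integrable (fun ζ => (‖x - ζ‖ ^ (n + 2))⁻¹ • (x - ζ)) ν :=
    (isRegularKernel_inv_norm_pow_smul (n + 1)).integrable hx
  have hinner := (hfield.const_inner (𝕜 := ℝ) c).const_mul 2
  have hdiff : Integrable (fun ζ => 2 * inner ℝ c ((‖x - ζ‖ ^ (n + 2))⁻¹ • (x - ζ)) -
      (1 - t ^ 2) * ‖c‖ ^ 2 * (‖x - ζ‖ ^ (n + 2))⁻¹) ν := hinner.sub ((hpot _).const_mul _)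
  have hae : (fun ζ => extremalKernel n c t (x - ζ)) =ᵐ[ν] fun ζ =>
      2 * inner ℝ c ((‖x - ζ‖ ^ (n + 2))⁻¹ • (x - ζ)) -
        (1 - t ^ 2) * ‖c‖ ^ 2 * (‖x - ζ‖ ^ (n + 2))⁻¹ - (‖x - ζ‖ ^ n)⁻¹ := by
    obtain ⟨δ, hδ, hfar⟩ := exists_ae_le_norm_sub hx
    filter_upwards [hfar] with ζ hζ
    exact extremalKernel_eq n c t (norm_pos_iff.1 (hδ.trans_le (hζ x (mem_ball_self hδ))))
  refine ⟨(hdiff.sub (hpot n)).congr hae.symm, ?_⟩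
  rw [integral_congr_ae hae, integral_sub hdiff (hpot n),
    integral_sub hinner ((hpot _).const_mul _), integral_const_mul, integral_const_mul,
    integral_inner hfield]
  rfl

variable [Nontrivial E]

theorem two_mul_inner_rieszField_le (hν : ν ≤ volume) (hx : x ∉ ν.support) {c : E} (hc : c ≠ 0)
    {t : ℝ} (ht0 : 0 ≤ t) (ht1 : t < 1) :
    2 * inner ℝ c (rieszField ν (finrank ℝ E + 2) x) ≤
      (1 - t ^ 2) * ‖c‖ ^ 2 * rieszPotential ν (finrank ℝ E + 2) x +
        rieszPotential ν (finrank ℝ E) x +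
        (surfaceMeasure E).real univ * (t ^ finrank ℝ E / (finrank ℝ E * (1 - t ^ 2)) -
          ∫ s in 0..t, s ^ (finrank ℝ E - 1) / (1 - s ^ 2)) := by
  let f := extremalKernel (finrank ℝ E) c t
  have hr : t * ‖c‖ < ‖c‖ := mul_lt_of_lt_one_left (norm_pos_iff.2 hc) ht1
  have hf : IntegrableOn f (ball c (t * ‖c‖)) := by
    have hcont : ContinuousOn f (closedBall c (t * ‖c‖)) :=
      ContinuousOn.mul (by fun_prop) <| (continuousOn_inv_norm_pow _).mono fun y hy hy0 => by
        rw [mem_singleton_iff] at hy0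
        rw [hy0, mem_closedBall, dist_zero_left] at hy
        exact hr.not_ge hy
    exact (hcont.integrableOn_compact (isCompact_closedBall _ _)).mono_set ball_subset_closedBall
  have hmp := Measure.measurePreserving_sub_left (volume : Measure E) x
  have hemb := (MeasurableEquiv.subLeft x).measurableEmbedding
  obtain ⟨hfν, hint⟩ := integrable_and_integral_extremalKernel (finrank ℝ E) c t hx
  have hpos : ∀ y ∈ ball c (t * ‖c‖), 0 ≤ f y := fun y hy => by
    have := pow_le_pow_left₀ (norm_nonneg _) (mem_ball_iff_norm.1 hy).le 2
    exact mul_nonneg (sub_nonneg.2 this) (by positivity)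
  have hneg : ∀ y ∉ ball c (t * ‖c‖), f y ≤ 0 := fun y hy => by
    rw [mem_ball_iff_norm, not_lt] at hy
    have := pow_le_pow_left₀ (by positivity) hy 2
    exact mul_nonpos_of_nonpos_of_nonneg (sub_nonpos.2 this) (by positivity)
  have hle := integral_le_setIntegral_of_measure_le hν
    (hmp.measurable measurableSet_ball) hfν ((hmp.integrableOn_comp_preimage hemb).2 hf)
    (fun ζ hζ => hpos _ hζ) (fun ζ hζ => hneg _ hζ)
  rw [hint, hmp.setIntegral_preimage_emb hemb f,
    setIntegral_ball_extremalKernel hc ht0 ht1] at hle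
  linarith

theorem norm_rieszField_sq_le (hν : ν ≤ volume) (hx : x ∉ ν.support) {t : ℝ} (ht0 : 0 ≤ t)
    (ht1 : t < 1) (hP : rieszPotential ν (finrank ℝ E) x ≤
      (surfaceMeasure E).real univ * ∫ s in 0..t, s ^ (finrank ℝ E - 1) / (1 - s ^ 2)) :
    ‖rieszField ν (finrank ℝ E + 2) x‖ ^ 2 ≤ (surfaceMeasure E).real univ / finrank ℝ E *
      t ^ finrank ℝ E * rieszPotential ν (finrank ℝ E + 2) x := by
  have hA := rieszPotential_nonneg ν (finrank ℝ E + 2) x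
  have hbound (c : E) (hc : c ≠ 0) := two_mul_inner_rieszField_le hν hx hc ht0 ht1
  set F := rieszField ν (finrank ℝ E + 2) x
  set A := rieszPotential ν (finrank ℝ E + 2) x
  have hden : 0 < 1 - t ^ 2 := by nlinarith
  set Q := (surfaceMeasure E).real univ * (t ^ finrank ℝ E / (finrank ℝ E * (1 - t ^ 2))) with hQ
  have hQ0 : 0 ≤ Q := by positivity
  have hRHS : (surfaceMeasure E).real univ / finrank ℝ E * t ^ finrank ℝ E * A =
      (1 - t ^ 2) * A * Q := by
    rw [hQ]
    field_simp
  rcases eq_or_ne F 0 with hF | hF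
  · rw [hF, norm_zero, zero_pow two_ne_zero]
    positivity
  have hquad (r : ℝ) :
      0 ≤ (1 - t ^ 2) * A * ‖F‖ ^ 2 * (r * r) + -(2 * ‖F‖ ^ 2) * r + Q := by
    rcases eq_or_ne r 0 with rfl | hr
    · simpa
    have := hbound (r • F) (smul_ne_zero hr hF)
    rw [real_inner_smul_left, real_inner_self_eq_norm_sq, norm_smul, mul_pow, Real.norm_eq_abs,
      sq_abs] at this
    linarith
  have hdiscrim := discrim_le_zero hquad
  have hF2 : 0 < ‖F‖ ^ 2 := by positivity
  rw [discrim] at hdiscrim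
  rw [hRHS]
  nlinarith

end FieldInequality

section DifferentialInequality

variable {E : Type*} [NormedAddCommGroup E] [InnerProductSpace ℝ E] [FiniteDimensional ℝ E]
  [MeasurableSpace E] [BorelSpace E] {ν : Measure E} [IsFiniteMeasure ν] {x : E}

theorem norm_rieszField_sq_mul_le (hn : 2 ≤ finrank ℝ E) (hν : ν ≤ volume) (hx : x ∉ ν.support)
    {v : ℝ} (hv0 : 0 < v)
    (hv : 2 / (surfaceMeasure E).real univ * rieszPotential ν (finrank ℝ E) x = v) :
    ‖rieszField ν (finrank ℝ E + 2) x‖ ^ 2 * (1 - (1 - 2 / (finrank ℝ E : ℝ)) * Real.exp (-v)) ≤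
      (surfaceMeasure E).real univ / finrank ℝ E * (1 - Real.exp (-v)) *
        rieszPotential ν (finrank ℝ E + 2) x := by
  have : Nontrivial E := nontrivial_of_finrank_pos (R := ℝ) (by omega)
  obtain ⟨t, ht0, ht1, htn, hle⟩ := exists_pow_mul_eq_one_sub_exp_neg hn hv0
  have hσ := surfaceMeasure_real_univ_pos (E := E)
  have hP : rieszPotential ν (finrank ℝ E) x ≤
      (surfaceMeasure E).real univ * ∫ s in 0..t, s ^ (finrank ℝ E - 1) / (1 - s ^ 2) := by
    rw [← hv, div_mul_eq_mul_div, div_le_iff₀ hσ] at hle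
    linarith
  have hden : 0 ≤ 1 - (1 - 2 / (finrank ℝ E : ℝ)) * Real.exp (-v) := by
    have : 0 < Real.exp (-v) := Real.exp_pos _
    have : Real.exp (-v) < 1 := by simpa
    have : (0 : ℝ) ≤ 2 / finrank ℝ E := by positivity
    nlinarith
  calc _ ≤ (surfaceMeasure E).real univ / finrank ℝ E * t ^ finrank ℝ E *
        rieszPotential ν (finrank ℝ E + 2) x *
          (1 - (1 - 2 / (finrank ℝ E : ℝ)) * Real.exp (-v)) :=
        mul_le_mul_of_nonneg_right (norm_rieszField_sq_le hν hx ht0 ht1 hP) hden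
    _ = _ := by
        rw [← htn]
        ring

/-- The function `1 - E_ν`, where `E_ν` is the exponential transform of the measure `ν`. -/
def oneSubExpTransform (ν : Measure E) (x : E) : ℝ :=
  1 - Real.exp (-(2 / (surfaceMeasure E).real univ * rieszPotential ν (finrank ℝ E) x))

theorem contDiffAt_oneSubExpTransform (hx : x ∉ ν.support) :
    ContDiffAt ℝ 2 (oneSubExpTransform ν) x :=
  contDiffAt_const.sub (contDiffAt_const.mul (contDiffAt_rieszPotential _ hx)).neg.exp

theorem oneSubExpTransform_pos [Nontrivial E] (hν : ν ≠ 0) (hx : x ∉ ν.support) :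
    0 < oneSubExpTransform ν x := by
  have hσ := surfaceMeasure_real_univ_pos (E := E)
  have hP := rieszPotential_pos (finrank ℝ E) hν hx
  rw [oneSubExpTransform, sub_pos, Real.exp_lt_one_iff, neg_lt_zero]
  positivity

theorem hasDerivAt_exp_neg_mul (c t : ℝ) :
    HasDerivAt (fun s => Real.exp (-(c * s))) (-(c * Real.exp (-(c * t)))) t := by
  refine (((hasDerivAt_id t).const_mul c).neg.exp).congr_deriv ?_
  rw [mul_one, mul_neg, mul_comm]
  rfl

theorem hasDerivAt_one_sub_exp_neg_mul (c t : ℝ) :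
    HasDerivAt (fun s => 1 - Real.exp (-(c * s))) (c * Real.exp (-(c * t))) t :=
  ((hasDerivAt_exp_neg_mul c t).const_sub 1).congr_deriv (neg_neg _)

theorem norm_gradient_oneSubExpTransform_sq (hx : x ∉ ν.support) :
    ‖∇ (oneSubExpTransform ν) x‖ ^ 2 =
      (2 * finrank ℝ E / (surfaceMeasure E).real univ * (1 - oneSubExpTransform ν x)) ^ 2 *
        ‖rieszField ν (finrank ℝ E + 2) x‖ ^ 2 := by
  have hW : HasFDerivAt (oneSubExpTransform ν) _ x :=
    (hasDerivAt_one_sub_exp_neg_mul _ _).comp_hasFDerivAt x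
      (hasGradientAt_rieszPotential (finrank ℝ E) hx).hasFDerivAt
  rw [← map_smul, ← hasGradientAt_iff_hasFDerivAt] at hW
  rw [hW.gradient, norm_smul, norm_smul, oneSubExpTransform]
  simp only [mul_pow, Real.norm_eq_abs, sq_abs]
  ring

theorem laplacian_oneSubExpTransform (hx : x ∉ ν.support) :
    Δ (oneSubExpTransform ν) x = (1 - oneSubExpTransform ν x) *
      (4 * finrank ℝ E / (surfaceMeasure E).real univ * rieszPotential ν (finrank ℝ E + 2) x -
        (2 * finrank ℝ E / (surfaceMeasure E).real univ) ^ 2 *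
          ‖rieszField ν (finrank ℝ E + 2) x‖ ^ 2) := by
  let c := 2 / (surfaceMeasure E).real univ
  have hΔ := laplacian_comp (.of_forall (hasDerivAt_one_sub_exp_neg_mul c))
    ((hasDerivAt_exp_neg_mul c _).const_mul c) (contDiffAt_rieszPotential (finrank ℝ E) hx)
  change Δ (oneSubExpTransform ν) x = _ at hΔ
  rw [hΔ, laplacian_rieszPotential _ hx, (hasGradientAt_rieszPotential _ hx).gradient, norm_smul,
    oneSubExpTransform]
  simp only [mul_pow, Real.norm_eq_abs, sq_abs]
  ring

theorem norm_gradient_oneSubExpTransform_sq_le (hn : 2 ≤ finrank ℝ E) (hν : ν ≤ volume)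
    (hν0 : ν ≠ 0) (hx : x ∉ ν.support) :
    2 / finrank ℝ E * ‖∇ (oneSubExpTransform ν) x‖ ^ 2 ≤
      oneSubExpTransform ν x * Δ (oneSubExpTransform ν) x := by
  have : Nontrivial E := nontrivial_of_finrank_pos (R := ℝ) (by omega)
  have hσ := surfaceMeasure_real_univ_pos (E := E)
  have hP := rieszPotential_pos (finrank ℝ E) hν0 hx
  have : (0 : ℝ) < finrank ℝ E := by exact_mod_cast two_pos.trans_le hn
  have hfield := norm_rieszField_sq_mul_le hn hν hx (by positivity) rfl
  rw [norm_gradient_oneSubExpTransform_sq hx, laplacian_oneSubExpTransform hx, oneSubExpTransform,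
    sub_sub_cancel]
  set e := Real.exp _
  have he : 0 < e := Real.exp_pos _
  rw [← sub_nonneg] at hfield ⊢
  refine (mul_nonneg (a := e * (2 * finrank ℝ E / (surfaceMeasure E).real univ) ^ 2)
    (by positivity) hfield).trans_eq ?_
  field_simp
  ring

end DifferentialInequality

section Density

variable {n : ℕ} {ρ : EuclideanSpace ℝ (Fin n) → ℝ} {x : EuclideanSpace ℝ (Fin n)}

/-- The measure with density `ρ`, whose support is `densitySupport ρ`. -/
def densityMeasure (ρ : EuclideanSpace ℝ (Fin n) → ℝ) : Measure (EuclideanSpace ℝ (Fin n)) :=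
  volume.withDensity fun x => ENNReal.ofReal (ρ x)

theorem IsDensity.densityMeasure_le (hρ : IsDensity ρ) : densityMeasure ρ ≤ volume := by
  calc densityMeasure ρ ≤ volume.withDensity 1 :=
        withDensity_mono (hρ.le_one.mono fun y hy => by simpa using hy)
    _ = volume := withDensity_one

theorem IsDensity.densityMeasure_ne_zero (hρ : IsDensity ρ) (hρ0 : ¬ ∀ᵐ x, ρ x = 0) :
    densityMeasure ρ ≠ 0 := fun hzero => hρ0 <| by
  rw [densityMeasure, withDensity_eq_zero_iff hρ.aemeasurable.ennreal_ofReal] at hzero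
  filter_upwards [hzero, hρ.nonneg] with ζ hle hge
  exact le_antisymm (ENNReal.ofReal_eq_zero.1 hle) hge

theorem IsDensity.isFiniteMeasure (hρ : IsDensity ρ) : IsFiniteMeasure (densityMeasure ρ) := by
  refine ⟨?_⟩
  calc densityMeasure ρ univ
      ≤ densityMeasure ρ (densitySupport ρ) + densityMeasure ρ (densitySupport ρ)ᶜ := by
        rw [← union_compl_self (densitySupport ρ)]
        exact measure_union_le _ _
    _ = densityMeasure ρ (densitySupport ρ) := by
        rw [show densityMeasure ρ (densitySupport ρ)ᶜ = 0 from Measure.measure_compl_support,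
          add_zero]
    _ ≤ volume (densitySupport ρ) := hρ.densityMeasure_le _
    _ < ⊤ := hρ.isCompact_support.measure_lt_top

theorem IsDensity.integrable_and_integral_eq (hρ : IsDensity ρ) (hx : x ∉ densitySupport ρ)
    (m : ℕ) : Integrable (fun ζ => ρ ζ / ‖x - ζ‖ ^ m) ∧
      ∫ ζ, ρ ζ / ‖x - ζ‖ ^ m = rieszPotential (densityMeasure ρ) m x := by
  have := hρ.isFiniteMeasure
  have hm := hρ.aemeasurable.ennreal_ofReal
  have hae : (fun ζ => (ENNReal.ofReal (ρ ζ)).toReal • (‖x - ζ‖ ^ m)⁻¹) =ᵐ[volume]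
      fun ζ => ρ ζ / ‖x - ζ‖ ^ m := by
    filter_upwards [hρ.nonneg] with ζ hζ
    rw [ENNReal.toReal_ofReal hζ, smul_eq_mul, div_eq_mul_inv]
  constructor
  · refine Integrable.congr ?_ hae
    exact (integrable_withDensity_iff_integrable_smul₀' hm (by simp)).1
      ((isRegularKernel_inv_norm_pow m).integrable (ν := densityMeasure ρ) hx)
  · rw [rieszPotential, densityMeasure,
      integral_withDensity_eq_integral_toReal_smul₀ hm (by simp), integral_congr_ae hae]

theorem IsDensity.one_sub_expTransform (hρ : IsDensity ρ) [NeZero n] (hx : x ∉ densitySupport ρ) :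
    1 - expTransform ρ x = oneSubExpTransform (densityMeasure ρ) x := by
  obtain ⟨hint, hpot⟩ := hρ.integrable_and_integral_eq hx n
  rw [expTransform, if_pos hint, hpot, oneSubExpTransform, sphereArea, surfaceMeasure_real_univ,
    finrank_euclideanSpace_fin, neg_mul]

end Density

section Subharmonic

variable {n : ℕ} {H : ℝ → ℝ} {κ : ℝ}

theorem subharmonicOn_comp_of_mul_norm_gradient_sq_le [NeZero n]
    {Ω : Set (EuclideanSpace ℝ (Fin n))} {w : EuclideanSpace ℝ (Fin n) → ℝ} {p : ℝ} (hκ : 0 ≤ κ)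
    (hH : ∀ t > 0, ContDiffAt ℝ 2 H t) (hH' : ∀ t > 0, HasDerivAt H (κ * t ^ (-p)) t)
    (hw : ∀ x ∈ Ω, ContDiffAt ℝ 2 w x) (hpos : ∀ x ∈ Ω, 0 < w x)
    (hgrad : ∀ x ∈ Ω, p * ‖∇ w x‖ ^ 2 ≤ w x * Δ w x) :
    SubharmonicOn (fun x => H (w x)) Ω := by
  refine subharmonicOn_of_laplacian_nonneg
    (fun x hx => (hH _ (hpos x hx)).comp x (hw x hx)) fun x hx => ?_
  have hwx := hpos x hx
  have hH'' : HasDerivAt (fun t => κ * t ^ (-p)) (κ * (-p * w x ^ (-p - 1))) (w x) :=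
    (Real.hasDerivAt_rpow_const (.inl hwx.ne')).const_mul κ
  have hpow : w x ^ (-p) = w x ^ (-p - 1) * w x := by
    rw [Real.rpow_sub_one hwx.ne', div_mul_cancel₀ _ hwx.ne']
  rw [laplacian_comp ((lt_mem_nhds hwx).mono hH') hH'' (hw x hx)]
  calc 0 ≤ κ * w x ^ (-p - 1) * (w x * Δ w x - p * ‖∇ w x‖ ^ 2) :=
        mul_nonneg (by positivity) (sub_nonneg.2 (hgrad x hx))
    _ = _ := by
        rw [hpow]
        ring

theorem IsDensity.subharmonicOn_comp_one_sub_expTransform {ρ : EuclideanSpace ℝ (Fin n) → ℝ}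
    (hρ : IsDensity ρ) (hρ0 : ¬ ∀ᵐ x, ρ x = 0) (hn : 2 ≤ n) (hκ : 0 ≤ κ)
    (hH : ∀ t > 0, ContDiffAt ℝ 2 H t)
    (hH' : ∀ t > 0, HasDerivAt H (κ * t ^ (-(2 / n : ℝ))) t) :
    SubharmonicOn (fun x => H (1 - expTransform ρ x)) (densitySupport ρ)ᶜ := by
  have : NeZero n := ⟨by omega⟩
  have := hρ.isFiniteMeasure
  have hν0 := hρ.densityMeasure_ne_zero hρ0
  have hfinrank : finrank ℝ (EuclideanSpace ℝ (Fin n)) = n := finrank_euclideanSpace_fin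
  refine (subharmonicOn_comp_of_mul_norm_gradient_sq_le hκ hH hH'
    (fun x hx => contDiffAt_oneSubExpTransform hx) (fun x hx => oneSubExpTransform_pos hν0 hx)
    fun x hx => ?_).congr fun x hx => congrArg H (hρ.one_sub_expTransform hx)
  have hgrad := norm_gradient_oneSubExpTransform_sq_le (hn.trans_eq hfinrank.symm)
    hρ.densityMeasure_le hν0 hx
  rwa [hfinrank] at hgrad

end Subharmonic

end ExpTransform

end

theorem theorem1p1 (n : ℕ) (ρ : EuclideanSpace ℝ (Fin n) → ℝ)
    (hρ : ExpTransform.IsDensity ρ) (hρ0 : ¬ (∀ᵐ x, ρ x = 0)) :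
    (n = 2 →
      ExpTransform.SubharmonicOn
        (fun x => Real.log (1 - ExpTransform.expTransform ρ x))
        (ExpTransform.densitySupport ρ)ᶜ) ∧
    (3 ≤ n →
      ExpTransform.SubharmonicOn
        (fun x => 1 / ((n : ℝ) - 2) *
          (1 - ExpTransform.expTransform ρ x) ^ (((n : ℝ) - 2) / (n : ℝ)))
        (ExpTransform.densitySupport ρ)ᶜ) := by
  refine ⟨fun hn => ?_, fun hn => ?_⟩
  · refine hρ.subharmonicOn_comp_one_sub_expTransform hρ0 hn.ge zero_le_one
      (fun t ht => Real.contDiffAt_log.2 ht.ne') fun t ht => ?_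
    refine (Real.hasDerivAt_log ht.ne').congr_deriv ?_
    rw [hn, Nat.cast_ofNat, div_self two_ne_zero, Real.rpow_neg_one, one_mul]
  · have hn2 : (0 : ℝ) < n - 2 := by
      have : (3 : ℝ) ≤ n := by exact_mod_cast hn
      linarith
    refine hρ.subharmonicOn_comp_one_sub_expTransform hρ0 (by omega) (κ := 1 / n) (by positivity)
      (fun t ht => contDiffAt_const.mul (Real.contDiffAt_rpow_const_of_ne ht.ne')) fun t ht => ?_
    refine ((Real.hasDerivAt_rpow_const (.inl ht.ne')).const_mul _).congr_deriv ?_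
    have hexp : ((n : ℝ) - 2) / n - 1 = -(2 / n) := by
      field_simp
      ring
    rw [hexp]
    field_simp
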